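/- Let $d\ge 6$. Write $\mathbb Z_d=\{0,\dots,d-1\}$ (arithmetic inside kets is modulo $d$), let $\{|i\rangle\}_{i\in\mathbb Z_d}$ be the computational basis of $\mathbb C^d$, and $w_x=e^{2\pi \mathrm{i}/x}$. States are nonzero vectors, not necessarily normalized; a product state of a multipartite system is a nonzero pure tensor. Definitions. An orthogonal product set (OPS) in a finite-dimensional multipartite Hilbert space $\mathcal H$ is a set $\mathcal S$ of mutually orthogonal product states whose span is a proper subspace of $\mathcal H$; $\mathcal H_{\mathcal S}^\perp$ denotes the orthogonal complement of its span. An OPS is an uncompletable product basis (UCPB) if $\mathcal H_{\mathcal S}^\perp$ contains fewer mutually orthogonal product states than its dimension, i.e. every set of mutually orthogonal product states in $\mathcal H_{\mathcal S}^\perp$ has fewer than $\dim\mathcal H_{\mathcal S}^\perp$ elements. It is an unextendible product basis (UPB) if it is a UCPB and $\mathcal H_{\mathcal S}^\perp$ contains no product state. It is a strongly uncompletable product basis (SUCPB) if in every locally extended Hilbert space $\mathcal H_{ext}$ (each local space being isometrically embedded in an arbitrary finite-dimensional Hilbert space) the orthogonal complement of $\mathcal S$ in $\mathcal H_{ext}$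 contains fewer mutually orthogonal product states than its dimension. For $k,i\in\mathbb Z_d$ define the following states in $\mathbb C^d\otimes\mathbb C^d\otimes\mathbb C^d$ (parties $A,B,C$): $$|V_{ki}^{m}\rangle=|k\rangle_A\Big(\sum_{j=0}^{\lfloor d/2\rfloor-2}w_{\lfloor d/2\rfloor-1}^{jm}\,|j+k+2+i\rangle\Big)_B|i\rangle_C,\qquad 0\le m\le \lfloor d/2\rfloor-2,$$ $$|H_{ki}^{n}\rangle=\Big(\sum_{j=0}^{\lceil d/2\rceil-2}w_{\lceil d/2\rceil-1}^{jn}\,|j+k+1-i\rangle\Big)_A|k\rangle_B|i\rangle_C,\qquad 0\le n\le \lceil d/2\rceil-2,$$ $$|C_{ki}^{s}\rangle=|k\rangle_A|i\rangle_B\big(|i-k-1\rangle+(-1)^s|i-k\rangle\big)_C,\qquad s\in\{0,1\},$$ and the stopper state $|S\rangle=\big(\sum_{i}|i\rangle\big)_A\big(\sum_{i}|i\rangle\big)_B\big(\sum_{i}|i\rangle\big)_C$. Theorem. For $d\ge 6$ the set $$\mathcal U^4=\bigcup_{k,i\in\mathbb Z_d}\Big(\bigcup_{m,n,s}\{|V_{ki}^m\rangle,|H_{ki}^n\rangle,|C_{ki}^s\rangle\}\setminus\{|V_{ki}^0\rangle,|H_{ki}^0\rangle,|C_{ki}^0\rangle\}\Big)\cup\{|S\rangle\}$$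 is a UPB of size $d^3-3d^2+1$ in $\mathbb C^d\otimes\mathbb C^d\otimes\mathbb C^d$. Moreover, viewed as a set of states of the bipartite system $A|BC$, of $B|CA$, or of $C|AB$ (two adjacent parties being merged into one with local space $\mathbb C^d\otimes\mathbb C^d$), it is in each case an SUCPB. -/

import Mathlib

open scoped TensorProduct

noncomputable section

namespace ProductBasis

/-! ### Product states and (strongly) uncompletable product bases

States are not normalized: a state is a nonzero vector. The tensor product carries Mathlib's
Hilbert space structure, `⟪a ⊗ b, a' ⊗ b'⟫ = ⟪a, a'⟫ * ⟪b, b'⟫`. -/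

/-- A product state of a bipartite system: a nonzero vector `a ⊗ b`. -/
def IsProductState₂ {E F : Type*} [NormedAddCommGroup E] [InnerProductSpace ℂ E]
    [NormedAddCommGroup F] [InnerProductSpace ℂ F] (ψ : E ⊗[ℂ] F) : Prop :=
  ψ ≠ 0 ∧ ∃ (a : E) (b : F), ψ = a ⊗ₜ[ℂ] b

/-- A product state of a tripartite system: a nonzero vector `a ⊗ b ⊗ c`. -/
def IsProductState₃ {E F G : Type*} [NormedAddCommGroup E] [InnerProductSpace ℂ E]
    [NormedAddCommGroup F] [InnerProductSpace ℂ F] [NormedAddCommGroup G] [InnerProductSpace ℂ G]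
    (ψ : E ⊗[ℂ] (F ⊗[ℂ] G)) : Prop :=
  ψ ≠ 0 ∧ ∃ (a : E) (b : F) (c : G), ψ = a ⊗ₜ[ℂ] (b ⊗ₜ[ℂ] c)

section General

/- `IsProd` is the notion of product state of the multipartite Hilbert space `H`. -/
variable {H : Type*} [NormedAddCommGroup H] [InnerProductSpace ℂ H]

/-- The complementary subspace of a set of vectors. -/
def compl (S : Set H) : Submodule ℂ H := (Submodule.span ℂ S)ᗮ

/-- An orthogonal product set: mutually orthogonal product states spanning a proper subspace. -/
def IsOPS (IsProd : H → Prop) (S : Set H) : Prop :=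
  (∀ ψ ∈ S, IsProd ψ) ∧ S.Pairwise (fun ψ φ => inner ℂ ψ φ = 0) ∧ Submodule.span ℂ S ≠ ⊤

/-- The complementary subspace of `S` contains fewer mutually orthogonal product states than its
dimension: every set of mutually orthogonal product states in it has fewer elements. -/
def ComplHasFewProductStates (IsProd : H → Prop) (S : Set H) : Prop :=
  ∀ T : Set H, (∀ ψ ∈ T, ψ ∈ compl S ∧ IsProd ψ) →
    T.Pairwise (fun ψ φ => inner ℂ ψ φ = 0) → T.encard < (Module.finrank ℂ (compl S) : ℕ∞)

/-- An uncompletable product basis. -/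
def IsUCPB (IsProd : H → Prop) (S : Set H) : Prop :=
  IsOPS IsProd S ∧ ComplHasFewProductStates IsProd S

/-- An unextendible product basis. -/
def IsUPB (IsProd : H → Prop) (S : Set H) : Prop :=
  IsUCPB IsProd S ∧ ∀ ψ ∈ compl S, ¬ IsProd ψ

end General

/-- A strongly uncompletable product basis of the bipartite system `E ⊗ F`: an orthogonal product
set that stays uncompletable in every locally extended Hilbert space `E' ⊗ F'`, where `E'` and `F'`
are finite-dimensional Hilbert spaces containing (isometric copies of) `E` and `F`. -/
def IsSUCPB {E F : Type} [NormedAddCommGroup E] [InnerProductSpace ℂ E]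
    [NormedAddCommGroup F] [InnerProductSpace ℂ F] (S : Set (E ⊗[ℂ] F)) : Prop :=
  IsOPS IsProductState₂ S ∧
    ∀ (E' F' : Type) [NormedAddCommGroup E'] [InnerProductSpace ℂ E'] [FiniteDimensional ℂ E']
      [NormedAddCommGroup F'] [InnerProductSpace ℂ F'] [FiniteDimensional ℂ F']
      (J₁ : E →ₗᵢ[ℂ] E') (J₂ : F →ₗᵢ[ℂ] F'),
      ComplHasFewProductStates IsProductState₂ (TensorProduct.mapIsometry J₁ J₂ '' S)

/-- The cyclic rearrangement `A ⊗ (B ⊗ C) ≃ B ⊗ (C ⊗ A)`, sending `a ⊗ b ⊗ c` to `b ⊗ c ⊗ a`. -/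
def cyc (E F G : Type*) [NormedAddCommGroup E] [InnerProductSpace ℂ E]
    [NormedAddCommGroup F] [InnerProductSpace ℂ F] [NormedAddCommGroup G] [InnerProductSpace ℂ G] :
    E ⊗[ℂ] (F ⊗[ℂ] G) ≃ₗᵢ[ℂ] F ⊗[ℂ] (G ⊗[ℂ] E) :=
  (TensorProduct.commIsometry ℂ E (F ⊗[ℂ] G)).trans (TensorProduct.assocIsometry ℂ F G E)

theorem cyc_tmul {E F G : Type*} [NormedAddCommGroup E] [InnerProductSpace ℂ E]
    [NormedAddCommGroup F] [InnerProductSpace ℂ F] [NormedAddCommGroup G] [InnerProductSpace ℂ G]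
    (a : E) (b : F) (c : G) :
    cyc E F G (a ⊗ₜ[ℂ] (b ⊗ₜ[ℂ] c)) = b ⊗ₜ[ℂ] (c ⊗ₜ[ℂ] a) := by
  simp [cyc]

/-! ### The set `𝒰⁴` -/

/-- The Hilbert space `ℂ^d`, with computational basis indexed by `ℤ_d`. -/
abbrev Qudit (d : ℕ) [NeZero d] : Type := EuclideanSpace ℂ (ZMod d)

/-- The Hilbert space `ℂ^d ⊗ ℂ^d ⊗ ℂ^d` of the parties `A`, `B`, `C`. -/
abbrev ThreeQudits (d : ℕ) [NeZero d] : Type := Qudit d ⊗[ℂ] (Qudit d ⊗[ℂ] Qudit d)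

variable (d : ℕ) [NeZero d]

/-- The computational basis state `|i⟩`. -/
def ket (i : ZMod d) : Qudit d := EuclideanSpace.single i 1

/-- The root of unity `w_x = e^{2πi/x}`. -/
def w (x : ℕ) : ℂ := Complex.exp (2 * Real.pi * Complex.I / x)

/-- The vertical tile state `|V_{ki}^m⟩`; here `d / 2 = ⌊d/2⌋`. -/
def V (k i : ZMod d) (m : ℕ) : ThreeQudits d :=
  ket d k ⊗ₜ[ℂ] ((∑ j ∈ Finset.range (d / 2 - 1),
    w (d / 2 - 1) ^ (j * m) • ket d ((j : ZMod d) + k + 2 + i)) ⊗ₜ[ℂ] ket d i)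

/-- The horizontal tile state `|H_{ki}^n⟩`; here `(d + 1) / 2 = ⌈d/2⌉`. -/
def H (k i : ZMod d) (n : ℕ) : ThreeQudits d :=
  (∑ j ∈ Finset.range ((d + 1) / 2 - 1),
    w ((d + 1) / 2 - 1) ^ (j * n) • ket d ((j : ZMod d) + k + 1 - i)) ⊗ₜ[ℂ]
      (ket d k ⊗ₜ[ℂ] ket d i)

/-- The crossed tile state `|C_{ki}^s⟩`. -/
def C (k i : ZMod d) (s : ℕ) : ThreeQudits d :=
  ket d k ⊗ₜ[ℂ] (ket d i ⊗ₜ[ℂ] (ket d (i - k - 1) + (-1 : ℂ) ^ s • ket d (i - k)))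

/-- The stopper state `|S⟩`. -/
def stopper : ThreeQudits d :=
  (∑ i, ket d i) ⊗ₜ[ℂ] ((∑ i, ket d i) ⊗ₜ[ℂ] (∑ i, ket d i))

/-- The set `𝒰⁴`: all tile states except the first one of each tile, and the stopper state. -/
def U4 : Set (ThreeQudits d) :=
  (⋃ (k : ZMod d) (i : ZMod d),
    (({ψ | ∃ m < d / 2 - 1, ψ = V d k i m} ∪ {ψ | ∃ n < (d + 1) / 2 - 1, ψ = H d k i n} ∪
      {ψ | ∃ s < 2, ψ = C d k i s}) \ {V d k i 0, H d k i 0, C d k i 0})) ∪ {stopper d}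

/-- A set of states of `ABC`, seen in the bipartition `A|BC`. -/
def inA_BC (S : Set (ThreeQudits d)) : Set (Qudit d ⊗[ℂ] (Qudit d ⊗[ℂ] Qudit d)) := S

/-- A set of states of `ABC`, seen in the bipartition `B|CA`. -/
def inB_CA (S : Set (ThreeQudits d)) : Set (Qudit d ⊗[ℂ] (Qudit d ⊗[ℂ] Qudit d)) :=
  cyc (Qudit d) (Qudit d) (Qudit d) '' S

/-- A set of states of `ABC`, seen in the bipartition `C|AB`. -/
def inC_AB (S : Set (ThreeQudits d)) : Set (Qudit d ⊗[ℂ] (Qudit d ⊗[ℂ] Qudit d)) :=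
  cyc (Qudit d) (Qudit d) (Qudit d) '' (cyc (Qudit d) (Qudit d) (Qudit d) '' S)

end ProductBasis

end

/-! The cells `(a, b, c)` of `ℤ_d³` are cut into lines (tiles) parallel to the axes, and the residue
`b - a - c` decides the direction of the line through a cell: `ℤ_d` is cut into three consecutive
arcs, one per direction, each of length at least 2 because `d ≥ 6`. The states kept from a tile are
its nonconstant Fourier modes. Hence a vector is orthogonal to `U4` exactly when its coordinates are
constant on each tile and sum to zero. Counting modes gives the size: each of the `3 d²` tiles loses
one state, and the stopper adds one.

The heart is a rigidity statement, `const_or_support_of_arcs`. Suppose that the coordinates of a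
vector of the complement factor as `a x * φ y z`, where `x` is the variable along the tiles of one
direction. If they do not vanish on all tiles of that direction, they are either globally constant,
which the zero sum forbids, or supported on tiles of that direction only.

Strong uncompletability follows. The functional `tileSum`, summing the coordinates over the tiles of
one direction, kills each product vector of the complement in the corresponding bipartition: such a
vector is zero on those tiles, or lives on them and has total sum zero. It does not kill the whole
complement (`tileDiff`), so product vectors cannot span it. Compressing by the adjoints of the local
isometries transfers this to any local extension (`isSUCPB_of_functional`).

For unextendibility, `φ y z = b y * c z` as well. Support on one value of `y + z` forces `b` and `c`
to be supported at one point each, while `a` is constant on its support; the total sum is then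
nonzero, a contradiction. The complement thus has no product state at all. -/

noncomputable section

namespace ProductBasis

/-! ### A criterion for strong uncompletability -/

/-- Pairwise orthogonal nonzero vectors of a subspace span it as soon as there are at least as many
of them as its dimension. -/
theorem le_span_of_finrank_le_encard {H : Type*} [NormedAddCommGroup H] [InnerProductSpace ℂ H]
    [FiniteDimensional ℂ H] (W : Submodule ℂ H) (T : Set H) (hW : ∀ ψ ∈ T, ψ ∈ W ∧ ψ ≠ 0)
    (hT : T.Pairwise (fun ψ φ => inner ℂ ψ φ = 0))
    (hcard : (Module.finrank ℂ W : ℕ∞) ≤ T.encard) : W ≤ Submodule.span ℂ T := by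
  -- `T` is not known to be finite, so a subset of exactly the right size is used.
  obtain ⟨T', hT'T, hT'⟩ := Set.exists_subset_encard_eq hcard
  have hfin : T'.Finite := Set.finite_of_encard_eq_coe hT'
  have : Fintype T' := hfin.fintype
  have hli : LinearIndependent ℂ (fun ψ : T' => (ψ : H)) :=
    linearIndependent_of_ne_zero_of_inner_eq_zero (fun ψ => (hW ψ (hT'T ψ.2)).2)
      fun ψ φ h => hT (hT'T ψ.2) (hT'T φ.2) fun h' => h (Subtype.ext h')
  have hle : Submodule.span ℂ T' ≤ W := Submodule.span_le.2 fun ψ hψ => (hW ψ (hT'T hψ)).1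
  have hrank : Module.finrank ℂ (Submodule.span ℂ T') = Module.finrank ℂ W := by
    have h1 := finrank_span_eq_card hli
    rw [Subtype.range_coe] at h1
    rw [h1, ← Set.toFinset_card, ← Set.ncard_eq_toFinset_card', Set.ncard, hT', ENat.toNat_natCast]
  rw [← Submodule.eq_of_le_of_finrank_eq hle hrank]
  exact Submodule.span_mono hT'T

theorem mem_compl {H : Type*} [NormedAddCommGroup H] [InnerProductSpace ℂ H] {S : Set H} {ψ : H} :
    ψ ∈ compl S ↔ ∀ φ ∈ S, inner ℂ φ ψ = 0 := by
  refine ⟨fun h φ hφ => h φ (Submodule.subset_span hφ), fun h => ?_⟩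
  rw [compl, Submodule.mem_orthogonal]
  intro φ hφ
  induction hφ using Submodule.span_induction with
  | mem φ hφ => exact h φ hφ
  | zero => simp
  | add φ φ' _ _ h h' => rw [inner_add_left, h, h', add_zero]
  | smul c φ _ h => rw [inner_smul_left, h, mul_zero]

theorem span_ne_top_of_mem_compl {H : Type*} [NormedAddCommGroup H] [InnerProductSpace ℂ H]
    {S : Set H} {ψ : H} (hψ : ψ ∈ compl S) (h0 : ψ ≠ 0) : Submodule.span ℂ S ≠ ⊤ := by
  intro h
  rw [compl, h, Submodule.top_orthogonal_eq_bot, Submodule.mem_bot] at hψ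
  exact h0 hψ

/-- An orthogonal set of product states is strongly uncompletable if some linear functional
vanishes on the product vectors of its complementary subspace, but not on the whole subspace. -/
theorem isSUCPB_of_functional {E F : Type} [NormedAddCommGroup E] [InnerProductSpace ℂ E]
    [FiniteDimensional ℂ E] [NormedAddCommGroup F] [InnerProductSpace ℂ F]
    [FiniteDimensional ℂ F] {S : Set (E ⊗[ℂ] F)} (hprod : ∀ ψ ∈ S, IsProductState₂ ψ)
    (horth : S.Pairwise (fun ψ φ => inner ℂ ψ φ = 0)) (l : E ⊗[ℂ] F →ₗ[ℂ] ℂ)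
    (hl : ∀ (a : E) (b : F), a ⊗ₜ[ℂ] b ∈ compl S → l (a ⊗ₜ[ℂ] b) = 0)
    {χ : E ⊗[ℂ] F} (hχ : χ ∈ compl S) (hlχ : l χ ≠ 0) : IsSUCPB S := by
  refine ⟨⟨hprod, horth, span_ne_top_of_mem_compl hχ ?_⟩, ?_⟩
  · rintro rfl
    exact hlχ (map_zero l)
  intro E' F' _ _ _ _ _ _ J₁ J₂ T hT hTorth
  by_contra! hcard
  have hspan := le_span_of_finrank_le_encard _ T (fun ψ hψ => ⟨(hT ψ hψ).1, (hT ψ hψ).2.1⟩)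
    hTorth hcard
  -- The compression `J₁† ⊗ J₂†` is a left inverse of the embedding, preserves the form `a ⊗ b`, and
  -- maps the extended complement to the original one.
  set P : E' ⊗[ℂ] F' →ₗ[ℂ] E ⊗[ℂ] F :=
    TensorProduct.map (LinearMap.adjoint J₁.toLinearMap) (LinearMap.adjoint J₂.toLinearMap)
    with hP
  have hadj (s : E ⊗[ℂ] F) (ψ : E' ⊗[ℂ] F') :
      inner ℂ (TensorProduct.mapIsometry J₁ J₂ s) ψ = inner ℂ s (P ψ) := by
    rw [hP, ← TensorProduct.adjoint_map, LinearMap.adjoint_inner_right,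
      TensorProduct.mapIsometry_apply]
  have hPJ (s : E ⊗[ℂ] F) : P (TensorProduct.mapIsometry J₁ J₂ s) = s :=
    ext_inner_left ℂ fun v => by rw [← hadj, LinearIsometry.inner_map_map]
  have hvanish : ∀ ψ ∈ Submodule.span ℂ T, l (P ψ) = 0 := by
    intro ψ hψ
    induction hψ using Submodule.span_induction with
    | mem ψ hψ =>
      obtain ⟨hmem, -, a, b, rfl⟩ := hT ψ hψ
      -- The compressed vector may be zero; this is why `hl` speaks of all `a ⊗ b` and not only of
      -- nonzero ones.
      have hc : P (a ⊗ₜ[ℂ] b) ∈ compl S := mem_compl.2 fun φ hφ => by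
        rw [← hadj]
        exact mem_compl.1 hmem _ ⟨φ, hφ, rfl⟩
      rw [hP, TensorProduct.map_tmul] at hc ⊢
      exact hl _ _ hc
    | zero => simp
    | add φ φ' _ _ h h' => rw [map_add, map_add, h, h', add_zero]
    | smul c φ _ h => rw [map_smul, map_smul, h, smul_zero]
  apply hlχ
  rw [← hPJ χ]
  refine hvanish _ (hspan (mem_compl.2 ?_))
  rintro _ ⟨φ, hφ, rfl⟩
  rw [LinearIsometry.inner_map_map]
  exact mem_compl.1 hχ φ hφ

/-! ### Rigidity of product functions that are constant on tiles -/

theorem eq_of_succ_eq {d : ℕ} [NeZero d] {α : Type*} {a : ZMod d → α}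
    (h : ∀ v, a (v + 1) = a v) (u v : ZMod d) : a u = a v := by
  have key (v : ZMod d) : a v = a 0 := by
    rw [← ZMod.natCast_zmod_val v]
    induction v.val with
    | zero => simp
    | succ n ih => rw [Nat.cast_succ, h, ih]
  rw [key u, key v]

/-- Let `ℤ_d` be cut into three consecutive arcs of lengths `l₁, l₂, l₃ ≥ 2`, and let
`a x * φ y z` be constant along `x`, `y` or `z` as long as `x + y + z` stays in the first, second or
third arc. If it is nonzero at a point of the first arc, it is either constant, or supported by a
single value of `y + z` and by the corresponding values of `x`, on which `a` is constant. -/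
theorem const_or_support_of_arcs {d : ℕ} [NeZero d] {l₁ l₂ l₃ : ℕ} (h₁ : 2 ≤ l₁) (h₂ : 2 ≤ l₂)
    (h₃ : 2 ≤ l₃) (hl : l₁ + l₂ + l₃ = d) (s : ZMod d) {a : ZMod d → ℂ}
    {φ : ZMod d → ZMod d → ℂ}
    (H₁ : ∀ (x y z : ZMod d) (j : ℕ), j + 1 < l₁ → x + y + z = s + j →
      a x * φ y z = a (x + 1) * φ y z)
    (H₂ : ∀ (x y z : ZMod d) (j : ℕ), j + 1 < l₂ → x + y + z = s + l₁ + j →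
      a x * φ y z = a x * φ (y + 1) z)
    (H₃ : ∀ (x y z : ZMod d) (j : ℕ), j + 1 < l₃ → x + y + z = s + l₁ + l₂ + j →
      a x * φ y z = a x * φ y (z + 1))
    {x₀ y₀ z₀ : ZMod d} {j₀ : ℕ} (hj₀ : j₀ < l₁) (he : x₀ + y₀ + z₀ = s + j₀)
    (h0 : a x₀ * φ y₀ z₀ ≠ 0) :
    (∀ x y z, a x * φ y z = a x₀ * φ y₀ z₀) ∨
      ((∀ y z, φ y z ≠ 0 → y + z = y₀ + z₀) ∧
        ∀ x, a x ≠ 0 → (∃ j < l₁, x + y₀ + z₀ = s + j) ∧ a x = a x₀) := by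
  have : Fact (1 < d) := ⟨by omega⟩
  -- Dividing by `φ y z` shows that `a` is constant on the translate of the first arc by `-(y + z)`.
  have harc (y z : ZMod d) (hφ : φ y z ≠ 0) (j : ℕ) (hj : j < l₁) :
      a (s - (y + z) + j) = a (s - (y + z)) := by
    induction j with
    | zero => simp
    | succ j ih =>
      rw [← ih (by omega), Nat.cast_succ, ← add_assoc]
      exact (mul_right_cancel₀ hφ (H₁ _ y z j hj (by ring))).symm
  obtain ⟨ha0, hφ0⟩ := mul_ne_zero_iff.1 h0
  set t := y₀ + z₀ with ht
  have hx₀ : x₀ = s - t + j₀ := by rw [ht]; linear_combination he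
  have hα (j : ℕ) (hj : j < l₁) : a (s - t + j) = a x₀ := by
    rw [harc y₀ z₀ hφ0 j hj, hx₀, harc y₀ z₀ hφ0 j₀ hj₀]
  -- Here `a ≠ 0` at the `l₁` points `s - t + j`. At level `y + z = t + r`, one of them puts `x + y
  -- + z` in the second arc, before its last point, as soon as `1 ≤ r ≤ l₁ + l₂ - 2`. The next claim
  -- does the same with the third arc.
  have hB (r : ℕ) (hr : 1 ≤ r) (hr' : r + 2 ≤ l₁ + l₂) (y z : ZMod d) (hyz : y + z = t + r) :
      φ y z = φ (y + 1) z := by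
    obtain ⟨j, j', hj, hj', hjj⟩ : ∃ j j', j < l₁ ∧ j' + 1 < l₂ ∧ r + j = l₁ + j' := by
      rcases lt_or_ge r l₂ with h | h
      · exact ⟨l₁ - 1, r - 1, by omega, by omega, by omega⟩
      · exact ⟨l₁ + l₂ - 2 - r, l₂ - 2, by omega, by omega, by omega⟩
    have hc : (r : ZMod d) + j = l₁ + j' := by exact_mod_cast congrArg (Nat.cast (R := ZMod d)) hjj
    exact mul_left_cancel₀ (by rwa [hα j hj])
      (H₂ (s - t + j) y z j' hj' (by linear_combination hyz + hc))
  have hC (r : ℕ) (hr : l₂ + 1 ≤ r) (hr' : r + 2 ≤ d) (y z : ZMod d) (hyz : y + z = t + r) :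
      φ y z = φ y (z + 1) := by
    obtain ⟨j, j', hj, hj', hjj⟩ : ∃ j j', j < l₁ ∧ j' + 1 < l₃ ∧ r + j = l₁ + l₂ + j' := by
      rcases lt_or_ge r (l₂ + l₃) with h | h
      · exact ⟨l₁ - 1, r - 1 - l₂, by omega, by omega, by omega⟩
      · exact ⟨d - 2 - r, l₃ - 2, by omega, by omega, by omega⟩
    have hc : (r : ZMod d) + j = l₁ + l₂ + j' := by
      exact_mod_cast congrArg (Nat.cast (R := ZMod d)) hjj
    exact mul_left_cancel₀ (by rwa [hα j hj])
      (H₃ (s - t + j) y z j' hj' (by linear_combination hyz + hc))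
  by_cases hsupp : ∀ y z, φ y z ≠ 0 → y + z = t
  · refine Or.inr ⟨hsupp, fun x hx => ?_⟩
    have hne (y z : ZMod d) (h : φ y z = φ y₀ z₀) : y + z = t := hsupp y z (by rwa [h])
    obtain ⟨r, hrd, hxr⟩ : ∃ r : ℕ, r < d ∧ x + y₀ + z₀ = s + r :=
      ⟨(x + y₀ + z₀ - s).val, ZMod.val_lt _, by rw [ZMod.natCast_zmod_val]; ring⟩
    -- Outside the first arc, `H₂` or `H₃` would carry the nonzero value `φ y₀ z₀` to a neighbouring
    -- level of `y + z`. At the last point of an arc the step arriving from its predecessor is used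
    -- instead.
    have hr₁ : r < l₁ := by
      by_contra! hge
      rcases lt_or_ge r (l₁ + l₂) with hlt | hge'
      · obtain ⟨j, rfl⟩ : ∃ j, r = l₁ + j := ⟨r - l₁, by omega⟩
        rw [Nat.cast_add] at hxr
        by_cases hj : j + 1 < l₂
        · have := hne (y₀ + 1) z₀
            (mul_left_cancel₀ hx (H₂ x y₀ z₀ j hj (by rw [hxr]; ring))).symm
          exact one_ne_zero (by linear_combination this + ht : (1 : ZMod d) = 0)
        · obtain ⟨j', rfl⟩ : ∃ j', j = j' + 1 := ⟨j - 1, by omega⟩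
          rw [Nat.cast_succ] at hxr
          have h := mul_left_cancel₀ hx (H₂ x (y₀ - 1) z₀ j' (by omega) (by
            linear_combination hxr))
          rw [sub_add_cancel] at h
          exact one_ne_zero (by linear_combination -hne (y₀ - 1) z₀ h - ht : (1 : ZMod d) = 0)
      · obtain ⟨j, rfl⟩ : ∃ j, r = l₁ + l₂ + j := ⟨r - (l₁ + l₂), by omega⟩
        rw [Nat.cast_add, Nat.cast_add] at hxr
        by_cases hj : j + 1 < l₃
        · have := hne y₀ (z₀ + 1)
            (mul_left_cancel₀ hx (H₃ x y₀ z₀ j hj (by rw [hxr]; ring))).symm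
          exact one_ne_zero (by linear_combination this + ht : (1 : ZMod d) = 0)
        · obtain ⟨j', rfl⟩ : ∃ j', j = j' + 1 := ⟨j - 1, by omega⟩
          rw [Nat.cast_succ] at hxr
          have h := mul_left_cancel₀ hx (H₃ x y₀ (z₀ - 1) j' (by omega) (by
            linear_combination hxr))
          rw [sub_add_cancel] at h
          exact one_ne_zero (by linear_combination -hne y₀ (z₀ - 1) h - ht : (1 : ZMod d) = 0)
    refine ⟨⟨r, hr₁, hxr⟩, ?_⟩
    rw [← hα r hr₁]
    congr 1
    linear_combination hxr + ht
  · push Not at hsupp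
    obtain ⟨y₁, z₁, hφ₁, hne⟩ := hsupp
    let P : ℕ → Prop := fun r => ∃ y z, y + z = t + r ∧ φ y z ≠ 0
    -- The ranges of `hB` and `hC` together cover `1 ≤ r ≤ d - 2` because `l₁ ≥ 2`. So one level
    -- other than `t` carrying a nonzero value of `φ` makes all of them do so.
    have hstep (r : ℕ) (hr : 1 ≤ r) (hr' : r + 2 ≤ d) : P r ↔ P (r + 1) := by
      rcases le_or_gt (r + 2) (l₁ + l₂) with h | h
      · constructor
        · rintro ⟨y, z, hyz, hφ⟩
          refine ⟨y + 1, z, by push_cast; linear_combination hyz, ?_⟩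
          rwa [← hB r hr h y z hyz]
        · rintro ⟨y, z, hyz, hφ⟩
          have hyz' : y - 1 + z = t + r := by push_cast at hyz; linear_combination hyz
          refine ⟨y - 1, z, hyz', ?_⟩
          rwa [hB r hr h _ z hyz', sub_add_cancel]
      · have h' : l₂ + 1 ≤ r := by omega
        constructor
        · rintro ⟨y, z, hyz, hφ⟩
          refine ⟨y, z + 1, by push_cast; linear_combination hyz, ?_⟩
          rwa [← hC r h' hr' y z hyz]
        · rintro ⟨y, z, hyz, hφ⟩
          have hyz' : y + (z - 1) = t + r := by push_cast at hyz; linear_combination hyz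
          refine ⟨y, z - 1, hyz', ?_⟩
          rwa [hC r h' hr' y _ hyz', sub_add_cancel]
    have hiff (r : ℕ) (hr : 1 ≤ r) (hr' : r + 1 ≤ d) : P r ↔ P 1 := by
      induction r, hr using Nat.le_induction with
      | base => rfl
      | succ r hr ih => rw [← hstep r hr (by omega), ih (by omega)]
    have hP1 : P 1 := by
      refine (hiff (y₁ + z₁ - t).val ?_ (ZMod.val_lt _)).1 ⟨y₁, z₁, ?_, hφ₁⟩
      · rw [Nat.one_le_iff_ne_zero, Ne, ZMod.val_eq_zero, sub_eq_zero]
        exact hne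
      · rw [ZMod.natCast_zmod_val]; ring
    have hall (u : ZMod d) : ∃ y z, y + z = u ∧ φ y z ≠ 0 := by
      by_cases hu : u = t
      · exact ⟨y₀, z₀, by rw [hu], hφ0⟩
      · obtain ⟨y, z, hyz, hφ⟩ := (hiff (u - t).val
          (by rwa [Nat.one_le_iff_ne_zero, Ne, ZMod.val_eq_zero, sub_eq_zero])
          (ZMod.val_lt _)).2 hP1
        exact ⟨y, z, by rw [hyz, ZMod.natCast_zmod_val]; ring, hφ⟩
    -- Every level is now available to `harc`, so the first step of the translated arc can start at
    -- any point. Once `a` is a nonzero constant, `x` can be chosen freely to apply `H₂` and `H₃` at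
    -- any `y, z`.
    have ha (x : ZMod d) : a x = a x₀ := by
      refine eq_of_succ_eq (fun v => ?_) x x₀
      obtain ⟨y, z, hyz, hφ⟩ := hall (s - v)
      have := harc y z hφ 1 (by omega)
      rwa [hyz, sub_sub_cancel, Nat.cast_one] at this
    have hy (y y' z : ZMod d) : φ y z = φ y' z := by
      refine eq_of_succ_eq (a := fun y => φ y z) (fun v => ?_) y y'
      refine (mul_left_cancel₀ ?_ (H₂ (s + l₁ - v - z) v z 0 (by omega) (by push_cast; ring))).symm
      rwa [ha]
    have hz (y z z' : ZMod d) : φ y z = φ y z' := by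
      refine eq_of_succ_eq (a := fun z => φ y z) (fun v => ?_) z z'
      refine (mul_left_cancel₀ ?_
        (H₃ (s + l₁ + l₂ - y - v) y v 0 (by omega) (by push_cast; ring))).symm
      rwa [ha]
    exact Or.inl fun x y z => by rw [ha, hy y y₀, hz y₀ z z₀]

/-! ### Roots of unity -/

theorem isPrimitiveRoot_w {L : ℕ} (hL : L ≠ 0) : IsPrimitiveRoot (w L) L :=
  Complex.isPrimitiveRoot_exp L hL

theorem star_w_mul_self {L : ℕ} (hL : L ≠ 0) : star (w L) * w L = 1 := by
  have h := Complex.conj_mul' (w L)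
  rwa [(isPrimitiveRoot_w hL).norm'_eq_one hL, Complex.ofReal_one, one_pow] at h

theorem sum_star_w_pow_mul_w_pow {L : ℕ} {m n : ℕ} (hm : m < L) (hn : n < L) :
    ∑ j : Fin L, star (w L ^ ((j : ℕ) * m)) * w L ^ ((j : ℕ) * n) =
      if m = n then (L : ℂ) else 0 := by
  have hL : L ≠ 0 := by omega
  have hterm (j : ℕ) : star (w L ^ (j * m)) * w L ^ (j * n) = (star (w L) ^ m * w L ^ n) ^ j := by
    rw [star_pow, mul_comm j m, mul_comm j n, pow_mul, pow_mul, mul_pow]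
  simp_rw [hterm]
  split_ifs with h
  · simp_rw [h, ← mul_pow, star_w_mul_self hL]
    simp
  · rw [Fin.sum_univ_eq_sum_range (fun j => (star (w L) ^ m * w L ^ n) ^ j) L]
    have hne : star (w L) ^ m * w L ^ n - 1 ≠ 0 := by
      intro h1
      refine h ((isPrimitiveRoot_w hL).pow_inj hm hn ?_)
      calc w L ^ m = w L ^ m * (star (w L) ^ m * w L ^ n) := by rw [sub_eq_zero.1 h1, mul_one]
        _ = (star (w L) * w L) ^ m * w L ^ n := by rw [mul_pow]; ring
        _ = w L ^ n := by rw [star_w_mul_self hL, one_pow, one_mul]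
    refine (mul_eq_zero.1 ((geom_sum_mul _ L).trans ?_)).resolve_right hne
    rw [mul_pow, ← pow_mul, ← pow_mul, mul_comm m, mul_comm n, pow_mul, pow_mul, ← star_pow,
      (isPrimitiveRoot_w hL).pow_eq_one, star_one, one_pow, one_pow, one_mul, sub_self]

/-! ### Sets of tile states

An orthonormal basis `e` whose index set is partitioned into tiles: the tile `τ` has `L τ` elements,
listed by `fun j => g ⟨τ, j⟩`. -/

section Tiles

variable {X κ ι : Type*} [NormedAddCommGroup X] [InnerProductSpace ℂ X] [Fintype κ] {L : ι → ℕ}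

/-- The `m`-th Fourier state of the tile `τ`. -/
def tileState (e : OrthonormalBasis κ ℂ X) (g : (Σ τ : ι, Fin (L τ)) ≃ κ) (τ : ι) (m : ℕ) : X :=
  ∑ j : Fin (L τ), w (L τ) ^ ((j : ℕ) * m) • e (g ⟨τ, j⟩)

/-- All Fourier states of all tiles, except the constant ones, and the sum of all basis states. -/
def tileSet (e : OrthonormalBasis κ ℂ X) (g : (Σ τ : ι, Fin (L τ)) ≃ κ) : Set X :=
  {ψ | ∃ τ m, 1 ≤ m ∧ m < L τ ∧ ψ = tileState e g τ m} ∪ {∑ k, e k}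

variable (e : OrthonormalBasis κ ℂ X) (g : (Σ τ : ι, Fin (L τ)) ≃ κ)

theorem inner_tileState (τ : ι) (m : ℕ) (ψ : X) :
    inner ℂ (tileState e g τ m) ψ =
      ∑ j : Fin (L τ), star (w (L τ) ^ ((j : ℕ) * m)) * e.repr ψ (g ⟨τ, j⟩) := by
  simp [tileState, OrthonormalBasis.repr_apply_apply, mul_comm]

theorem inner_sum_basis (ψ : X) : inner ℂ (∑ k, e k) ψ = ∑ k, e.repr ψ k := by
  simp [OrthonormalBasis.repr_apply_apply]

theorem inner_sum_basis_self (k : κ) : inner ℂ (∑ k, e k) (e k) = 1 := by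
  classical
  rw [inner_sum_basis]
  simp

theorem repr_tileState_self (τ : ι) (m : ℕ) (j : Fin (L τ)) :
    e.repr (tileState e g τ m) (g ⟨τ, j⟩) = w (L τ) ^ ((j : ℕ) * m) := by
  classical
  simp [tileState, Pi.single_apply]

theorem repr_tileState_of_ne {τ σ : ι} (h : τ ≠ σ) (m : ℕ) (j : Fin (L σ)) :
    e.repr (tileState e g τ m) (g ⟨σ, j⟩) = 0 := by
  classical
  simp [tileState, h.symm]

theorem inner_tileState_of_ne {τ σ : ι} (h : τ ≠ σ) (m n : ℕ) :
    inner ℂ (tileState e g τ m) (tileState e g σ n) = 0 := by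
  simp [inner_tileState, repr_tileState_of_ne e g h.symm]

theorem inner_tileState_same {τ : ι} {m n : ℕ} (hm : m < L τ) (hn : n < L τ) :
    inner ℂ (tileState e g τ m) (tileState e g τ n) = if m = n then (L τ : ℂ) else 0 := by
  simp_rw [inner_tileState, repr_tileState_self, sum_star_w_pow_mul_w_pow hm hn]

theorem tileState_ne_zero {τ : ι} {m : ℕ} (hm : m < L τ) : tileState e g τ m ≠ 0 := by
  intro h
  have h1 := inner_tileState_same e g hm hm
  rw [h, inner_zero_left, if_pos rfl] at h1
  exact (by omega : L τ ≠ 0) (by exact_mod_cast h1.symm)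

theorem inner_tileState_eq_zero {τ σ : ι} {m n : ℕ} (hm : m < L τ) (hn : n < L σ)
    (h : ¬ (τ = σ ∧ m = n)) : inner ℂ (tileState e g τ m) (tileState e g σ n) = 0 := by
  by_cases hτ : τ = σ
  · subst hτ
    rw [inner_tileState_same e g hm hn, if_neg fun h' => h ⟨rfl, h'⟩]
  · exact inner_tileState_of_ne e g hτ m n

theorem tileState_inj {τ σ : ι} {m n : ℕ} (hm : m < L τ) (hn : n < L σ) :
    tileState e g τ m = tileState e g σ n ↔ τ = σ ∧ m = n := by
  refine ⟨fun h => ?_, ?_⟩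
  · by_contra hne
    have := inner_tileState_eq_zero e g hm hn hne
    rw [← h, inner_self_eq_zero] at this
    exact tileState_ne_zero e g hm this
  · rintro ⟨rfl, rfl⟩
    rfl

theorem inner_sum_basis_tileState {τ : ι} {m : ℕ} (hm : m < L τ) :
    inner ℂ (∑ k, e k) (tileState e g τ m) = if m = 0 then (L τ : ℂ) else 0 := by
  have hsum := sum_star_w_pow_mul_w_pow (show 0 < L τ by omega) hm
  simp only [mul_zero, pow_zero, star_one, one_mul] at hsum
  simp_rw [tileState, inner_sum, inner_smul_right, inner_sum_basis_self, mul_one, hsum, eq_comm]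

theorem sum_basis_ne_zero [Nonempty κ] : ∑ k, e k ≠ 0 := by
  intro h
  obtain ⟨k⟩ := ‹Nonempty κ›
  have h1 := inner_sum_basis_self e k
  rw [h, inner_zero_left] at h1
  exact zero_ne_one h1

theorem tileSet_pairwise : (tileSet e g).Pairwise (fun ψ φ => inner ℂ ψ φ = 0) := by
  have hS (τ : ι) (m : ℕ) (hm : 1 ≤ m) (hL : m < L τ) :
      inner ℂ (∑ k, e k) (tileState e g τ m) = 0 := by
    rw [inner_sum_basis_tileState e g hL, if_neg (by omega)]
  rintro _ (⟨τ, m, hm, hmL, rfl⟩ | rfl) _ (⟨σ, n, hn, hnL, rfl⟩ | rfl) hne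
  · exact inner_tileState_eq_zero e g hmL hnL
      fun h => hne ((tileState_inj e g hmL hnL).2 h)
  · exact inner_eq_zero_symm.1 (hS τ m hm hmL)
  · exact hS σ n hn hnL
  · exact absurd rfl hne

/-- Fourier inversion on the tile: of all modes only `m = 0` can have a nonzero coefficient, and
that mode does not depend on the position in the tile. -/
theorem repr_eq_of_mem_compl {ψ : X} (hψ : ψ ∈ compl (tileSet e g)) (τ : ι)
    (i j : Fin (L τ)) : e.repr ψ (g ⟨τ, i⟩) = e.repr ψ (g ⟨τ, j⟩) := by
  have key (i : Fin (L τ)) :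
      (L τ : ℂ) * e.repr ψ (g ⟨τ, i⟩) = ∑ j : Fin (L τ), e.repr ψ (g ⟨τ, j⟩) := by
    have hpos : 0 < L τ := i.pos
    calc (L τ : ℂ) * e.repr ψ (g ⟨τ, i⟩)
        = ∑ j : Fin (L τ), (∑ m : Fin (L τ),
            star (w (L τ) ^ ((m : ℕ) * j)) * w (L τ) ^ ((m : ℕ) * i)) * e.repr ψ (g ⟨τ, j⟩) := by
          simp_rw [sum_star_w_pow_mul_w_pow (Fin.is_lt _) (Fin.is_lt _), Fin.val_inj]
          simp
      _ = ∑ m : Fin (L τ), w (L τ) ^ ((m : ℕ) * i) * inner ℂ (tileState e g τ m) ψ := by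
          simp_rw [Finset.sum_mul, inner_tileState, Finset.mul_sum]
          rw [Finset.sum_comm]
          refine Finset.sum_congr rfl fun m _ => Finset.sum_congr rfl fun j _ => ?_
          rw [mul_comm (m : ℕ) j]
          ring
      _ = inner ℂ (tileState e g τ 0) ψ := by
          rw [Finset.sum_eq_single (⟨0, hpos⟩ : Fin (L τ))]
          · simp
          · intro m _ hm
            rw [mem_compl.1 hψ _ (Or.inl ⟨τ, m, Nat.one_le_iff_ne_zero.2 fun h => hm (Fin.ext h),
              m.2, rfl⟩), mul_zero]
          · simp
      _ = _ := by simp [inner_tileState]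
  exact mul_left_cancel₀ (by exact_mod_cast i.pos.ne' : (L τ : ℂ) ≠ 0) ((key i).trans (key j).symm)

theorem sum_repr_of_mem_compl {ψ : X} (hψ : ψ ∈ compl (tileSet e g)) :
    ∑ k, e.repr ψ k = 0 := by
  rw [← inner_sum_basis]
  exact mem_compl.1 hψ _ (Or.inr rfl)

/-- The balanced difference of the constant states of two tiles. -/
def tileDiff (τ σ : ι) : X :=
  (L σ : ℂ) • tileState e g τ 0 - (L τ : ℂ) • tileState e g σ 0

theorem tileDiff_mem_compl {τ σ : ι} (hτ : 0 < L τ) (hσ : 0 < L σ) :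
    tileDiff e g τ σ ∈ compl (tileSet e g) := by
  refine mem_compl.2 ?_
  rintro _ (⟨ρ, m, hm, hmL, rfl⟩ | rfl)
  · rw [tileDiff, inner_sub_right, inner_smul_right, inner_smul_right,
      inner_tileState_eq_zero e g hmL hτ (by omega), inner_tileState_eq_zero e g hmL hσ (by omega)]
    simp
  · rw [tileDiff, inner_sub_right, inner_smul_right, inner_smul_right,
      inner_sum_basis_tileState e g hτ, inner_sum_basis_tileState e g hσ]
    simp [mul_comm]

theorem ncard_tileSet [Fintype ι] [Nonempty κ] :
    (tileSet e g).ncard = ∑ τ, (L τ - 1) + 1 := by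
  let f : (Σ τ : ι, Fin (L τ - 1)) → X := fun p => tileState e g p.1 (p.2 + 1)
  have hlt (p : Σ τ : ι, Fin (L τ - 1)) : (p.2 : ℕ) + 1 < L p.1 := by have := p.2.2; omega
  have hf : Function.Injective f := by
    rintro ⟨τ, i⟩ ⟨σ, j⟩ h
    obtain ⟨rfl, h'⟩ := (tileState_inj e g (hlt ⟨τ, i⟩) (hlt ⟨σ, j⟩)).1 h
    simpa [Fin.val_inj] using h'
  have hrange : {ψ | ∃ τ m, 1 ≤ m ∧ m < L τ ∧ ψ = tileState e g τ m} = Set.range f := by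
    ext ψ
    constructor
    · rintro ⟨τ, m, hm, hmL, rfl⟩
      exact ⟨⟨τ, ⟨m - 1, by omega⟩⟩, by simp only [f]; congr 1; omega⟩
    · rintro ⟨p, rfl⟩
      exact ⟨p.1, p.2 + 1, by omega, hlt p, rfl⟩
  -- The stopper is nonzero and orthogonal to every nonconstant mode, hence is none of them.
  have hS : ∑ k, e k ∉ Set.range f := by
    rintro ⟨p, hp⟩
    have h := inner_sum_basis_tileState e g (hlt p)
    rw [if_neg (by omega)] at h
    change inner ℂ (∑ k, e k) (f p) = 0 at h
    rw [hp, inner_self_eq_zero] at h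
    exact sum_basis_ne_zero e h
  rw [tileSet, hrange, Set.union_singleton, Set.ncard_insert_of_notMem hS (Set.finite_range f),
    ← Set.image_univ, Set.ncard_image_of_injective _ hf, Set.ncard_univ, Nat.card_eq_fintype_card,
    Fintype.card_sigma]
  simp

end Tiles

/-! ### The tiles of `𝒰⁴` -/

/-- The number of cells of the tiles of direction `A`, `C`, `B` (in this order). -/
def arcLength (d : ℕ) (t : Fin 3) : ℕ := ![(d + 1) / 2 - 1, 2, d / 2 - 1] t

theorem arcLength_sum {d : ℕ} (hd : 6 ≤ d) : arcLength d 0 + arcLength d 1 + arcLength d 2 = d := by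
  simp only [arcLength, Matrix.cons_val]
  omega

theorem two_le_arcLength {d : ℕ} (hd : 6 ≤ d) (t : Fin 3) : 2 ≤ arcLength d t := by
  fin_cases t <;> simp [arcLength] <;> omega

section Cells

variable (d : ℕ) [NeZero d]

/-- Tiles are indexed by their direction and the two constants `k, i`. -/
abbrev TileIndex : Type := Fin 3 × ZMod d × ZMod d

/-- The number of cells of a tile. -/
abbrev tileLength (τ : TileIndex d) : ℕ := arcLength d τ.1

variable {d}

/-- The cells of a tile; the tiles are those of `H_{ki}`, `C_{ki}` and `V_{ki}`. -/
def tileCell : (Σ τ : TileIndex d, Fin (tileLength d τ)) → ZMod d × ZMod d × ZMod d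
  | ⟨(0, k, i), j⟩ => ((j : ℕ) + k + 1 - i, k, i)
  | ⟨(1, k, i), j⟩ => (k, i, i - k - 1 + (j : ℕ))
  | ⟨(2, k, i), j⟩ => (k, (j : ℕ) + k + 2 + i, i)

/-- The value of `b - a - c` is `1 - j` on the tiles of `C`, `2 + j` on those of `V` and `-1 - j` on
those of `H`; these fill `{0, 1}`, `{2, …, ⌊d/2⌋}` and the remaining residues. -/
theorem tileCell_surjective (hd : 6 ≤ d) : Function.Surjective (tileCell (d := d)) := by
  rintro ⟨a, b, c⟩
  obtain ⟨n, hn, hu⟩ : ∃ n : ℕ, n < d ∧ b - a - c = n :=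
    ⟨(b - a - c).val, ZMod.val_lt _, (ZMod.natCast_zmod_val _).symm⟩
  rcases lt_or_ge n 2 with h | h
  · refine ⟨⟨(1, a, b), ⟨1 - n, by simp only [tileLength, arcLength, Matrix.cons_val]; omega⟩⟩, ?_⟩
    have : ((1 - n : ℕ) : ZMod d) = 1 - n := by rw [Nat.cast_sub (by omega), Nat.cast_one]
    simp only [tileCell, this, Prod.mk.injEq, true_and]
    linear_combination hu
  rcases le_or_gt n (d / 2) with h' | h'
  · refine ⟨⟨(2, a, c), ⟨n - 2, by simp only [tileLength, arcLength, Matrix.cons_val]; omega⟩⟩, ?_⟩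
    have : ((n - 2 : ℕ) : ZMod d) = n - 2 := by rw [Nat.cast_sub (by omega), Nat.cast_two]
    simp only [tileCell, this, Prod.mk.injEq, true_and, and_true]
    linear_combination -hu
  · refine ⟨⟨(0, b, c), ⟨d - 1 - n, by
      simp only [tileLength, arcLength, Matrix.cons_val]; omega⟩⟩, ?_⟩
    have : ((d - 1 - n : ℕ) : ZMod d) = -1 - n := by
      rw [Nat.cast_sub (by omega), Nat.cast_sub (by omega), Nat.cast_one, ZMod.natCast_self,
        zero_sub]
    simp only [tileCell, this, Prod.mk.injEq, and_true]
    linear_combination hu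

theorem sum_tileLength (f : ℕ → ℕ) :
    ∑ τ : TileIndex d, f (tileLength d τ) =
      d ^ 2 * (f (arcLength d 0) + f (arcLength d 1) + f (arcLength d 2)) := by
  simp only [TileIndex, tileLength, Fintype.sum_prod_type, Finset.sum_const, Finset.card_univ,
    Fintype.card_prod, ZMod.card, smul_eq_mul, Fin.sum_univ_three]
  ring

/-- Disjointness of the tiles comes from counting: `d²` tiles per direction, with lengths summing to
`d`, give `d³` cells. -/
theorem tileCell_bijective (hd : 6 ≤ d) : Function.Bijective (tileCell (d := d)) := by
  refine (Fintype.bijective_iff_surjective_and_card _).2 ⟨tileCell_surjective hd, ?_⟩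
  simp only [Fintype.card_sigma, Fintype.card_fin, Fintype.card_prod, ZMod.card]
  rw [sum_tileLength fun n => n, arcLength_sum hd]
  ring

/-- The partition of the cells into tiles. -/
def tiling (hd : 6 ≤ d) : (Σ τ : TileIndex d, Fin (tileLength d τ)) ≃ ZMod d × ZMod d × ZMod d :=
  Equiv.ofBijective tileCell (tileCell_bijective hd)

variable (d) in
/-- The computational basis of `ℂ^d`. -/
def ketBasis : OrthonormalBasis (ZMod d) ℂ (Qudit d) := EuclideanSpace.basisFun (ZMod d) ℂ

variable (d) in
/-- The computational basis of `ℂ^d ⊗ ℂ^d ⊗ ℂ^d`. -/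
def ket₃ : OrthonormalBasis (ZMod d × ZMod d × ZMod d) ℂ (ThreeQudits d) :=
  (ketBasis d).tensorProduct ((ketBasis d).tensorProduct (ketBasis d))

theorem ketBasis_apply (i : ZMod d) : ketBasis d i = ket d i := by
  simp [ketBasis, ket]

theorem ket₃_apply (a b c : ZMod d) :
    ket₃ d (a, b, c) = ket d a ⊗ₜ[ℂ] (ket d b ⊗ₜ[ℂ] ket d c) := by
  simp [ket₃, ketBasis_apply]

theorem H_eq_tileState (hd : 6 ≤ d) (k i : ZMod d) (m : ℕ) :
    H d k i m = tileState (ket₃ d) (tiling hd) (0, k, i) m := by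
  simp only [H, tileState, tiling, Equiv.ofBijective_apply, tileCell, ket₃_apply]
  rw [TensorProduct.sum_tmul, ← Fin.sum_univ_eq_sum_range (fun j =>
    (w ((d + 1) / 2 - 1) ^ (j * m) • ket d ((j : ZMod d) + k + 1 - i)) ⊗ₜ[ℂ]
      (ket d k ⊗ₜ[ℂ] ket d i))]
  rfl

theorem V_eq_tileState (hd : 6 ≤ d) (k i : ZMod d) (m : ℕ) :
    V d k i m = tileState (ket₃ d) (tiling hd) (2, k, i) m := by
  simp only [V, tileState, tiling, Equiv.ofBijective_apply, tileCell, ket₃_apply]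
  rw [TensorProduct.sum_tmul, TensorProduct.tmul_sum, ← Fin.sum_univ_eq_sum_range (fun j =>
    ket d k ⊗ₜ[ℂ] ((w (d / 2 - 1) ^ (j * m) • ket d ((j : ZMod d) + k + 2 + i)) ⊗ₜ[ℂ] ket d i))]
  simp only [← TensorProduct.smul_tmul', TensorProduct.tmul_smul]
  rfl

theorem w_two : w 2 = -1 := by
  rw [w, ← Complex.exp_pi_mul_I]
  congr 1
  push_cast
  ring

theorem C_eq_tileState (hd : 6 ≤ d) (k i : ZMod d) (s : ℕ) :
    C d k i s = tileState (ket₃ d) (tiling hd) (1, k, i) s := by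
  have h : tileState (ket₃ d) (tiling hd) (1, k, i) s =
      ∑ j : Fin 2, w 2 ^ ((j : ℕ) * s) •
        (ket d k ⊗ₜ[ℂ] (ket d i ⊗ₜ[ℂ] ket d (i - k - 1 + (j : ℕ)))) := by
    simp only [tileState, tiling, Equiv.ofBijective_apply, tileCell, ket₃_apply]
    rfl
  rw [h, Fin.sum_univ_two, w_two]
  simp [C, TensorProduct.tmul_add]

theorem stopper_eq_sum : stopper d = ∑ k, ket₃ d k := by
  simp_rw [stopper, Fintype.sum_prod_type, ket₃_apply, TensorProduct.sum_tmul,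
    TensorProduct.tmul_sum]

theorem U4_eq_tileSet (hd : 6 ≤ d) : U4 d = tileSet (ket₃ d) (tiling hd) := by
  have hpos (t : Fin 3) : 0 < arcLength d t := by have := two_le_arcLength hd t; omega
  rw [U4, tileSet, stopper_eq_sum]
  congr 1
  ext ψ
  simp only [V_eq_tileState hd, H_eq_tileState hd, C_eq_tileState hd, Set.mem_iUnion, Set.mem_sdiff,
    Set.mem_union, Set.mem_ofPred_eq, Set.mem_insert_iff, Set.mem_singleton_iff]
  constructor
  · rintro ⟨k, i, (⟨m, hm, rfl⟩ | ⟨m, hm, rfl⟩) | ⟨m, hm, rfl⟩, hne⟩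
    · refine ⟨(2, k, i), m, Nat.one_le_iff_ne_zero.2 ?_, hm, rfl⟩
      rintro rfl
      exact hne (Or.inl rfl)
    · refine ⟨(0, k, i), m, Nat.one_le_iff_ne_zero.2 ?_, hm, rfl⟩
      rintro rfl
      exact hne (Or.inr (Or.inl rfl))
    · refine ⟨(1, k, i), m, Nat.one_le_iff_ne_zero.2 ?_, hm, rfl⟩
      rintro rfl
      exact hne (Or.inr (Or.inr rfl))
  · rintro ⟨⟨t, k, i⟩, m, hm, hmL, rfl⟩
    refine ⟨k, i, ?_, ?_⟩
    · fin_cases t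
      · exact Or.inl (Or.inr ⟨m, hmL, rfl⟩)
      · exact Or.inr ⟨m, hmL, rfl⟩
      · exact Or.inl (Or.inl ⟨m, hmL, rfl⟩)
    · rintro (h | h | h) <;>
      · have := ((tileState_inj _ _ hmL (hpos _)).1 h).2
        omega

theorem ncard_U4 (hd : 6 ≤ d) : ((U4 d).ncard : ℤ) = (d : ℤ) ^ 3 - 3 * (d : ℤ) ^ 2 + 1 := by
  rw [U4_eq_tileSet hd, ncard_tileSet, sum_tileLength fun n => n - 1]
  have hsum := arcLength_sum hd
  have h0 := two_le_arcLength hd 0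
  have h1 := two_le_arcLength hd 1
  have h2 := two_le_arcLength hd 2
  have : arcLength d 0 - 1 + (arcLength d 1 - 1) + (arcLength d 2 - 1) = d - 3 := by omega
  rw [this]
  push_cast [Nat.cast_sub (show 3 ≤ d by omega)]
  ring

end Cells

/-! ### Product vectors in the complementary subspace -/

section Arcs

variable {d : ℕ}

/-- A function on `ℤ_d³` that is constant along its first, second or third variable as long as the
sum of the variables stays in the arc starting at `s`, `s + l₁` or `s + l₁ + l₂`, of length `l₁`,
`l₂` or `l₃`. -/
structure IsTileFunction (l₁ l₂ l₃ : ℕ) (s : ZMod d) (F : ZMod d → ZMod d → ZMod d → ℂ) :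
    Prop where
  first : ∀ (x y z : ZMod d) (j : ℕ), j + 1 < l₁ → x + y + z = s + j → F x y z = F (x + 1) y z
  second : ∀ (x y z : ZMod d) (j : ℕ), j + 1 < l₂ → x + y + z = s + l₁ + j →
    F x y z = F x (y + 1) z
  third : ∀ (x y z : ZMod d) (j : ℕ), j + 1 < l₃ → x + y + z = s + l₁ + l₂ + j →
    F x y z = F x y (z + 1)

/-- The three arcs close up cyclically, so any of them can play the role of the first. This lets one
rigidity statement serve all three directions. -/
theorem IsTileFunction.rotate {l₁ l₂ l₃ : ℕ} {s : ZMod d} {F : ZMod d → ZMod d → ZMod d → ℂ}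
    (h : IsTileFunction l₁ l₂ l₃ s F) (hl : l₁ + l₂ + l₃ = d) :
    IsTileFunction l₂ l₃ l₁ (s + (l₁ : ZMod d)) (fun y z x => F x y z) where
  first y z x j hj he := h.second x y z j hj (by rw [← he]; ring)
  second y z x j hj he := h.third x y z j hj (by rw [← he]; ring)
  third y z x j hj he := h.first x y z j hj (by
    have hd : (l₁ : ZMod d) + l₂ + l₃ = 0 := by
      rw [← ZMod.natCast_self d, ← hl, Nat.cast_add, Nat.cast_add]
    linear_combination he + hd)

variable [NeZero d]

/-- Orthogonality to the stopper excludes the constant alternative, whose sum would be `d³` times a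
nonzero number. -/
theorem IsTileFunction.const_or_support {l₁ l₂ l₃ : ℕ} (h₁ : 2 ≤ l₁) (h₂ : 2 ≤ l₂) (h₃ : 2 ≤ l₃)
    (hl : l₁ + l₂ + l₃ = d) {s : ZMod d} {a : ZMod d → ℂ} {φ : ZMod d → ZMod d → ℂ}
    (h : IsTileFunction l₁ l₂ l₃ s fun x y z => a x * φ y z)
    (hsum : ∑ x, ∑ y, ∑ z, a x * φ y z = 0) {x₀ y₀ z₀ : ZMod d} {j₀ : ℕ} (hj₀ : j₀ < l₁)
    (he : x₀ + y₀ + z₀ = s + j₀) (h0 : a x₀ * φ y₀ z₀ ≠ 0) :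
    (∀ y z, φ y z ≠ 0 → y + z = y₀ + z₀) ∧
      ∀ x, a x ≠ 0 → (∃ j < l₁, x + y₀ + z₀ = s + j) ∧ a x = a x₀ := by
  rcases const_or_support_of_arcs h₁ h₂ h₃ hl s h.first h.second h.third hj₀ he h0 with h | h
  · simp_rw [h] at hsum
    simp only [Finset.sum_const, Finset.card_univ, ZMod.card, nsmul_eq_mul, mul_eq_zero, NeZero.ne,
      false_or] at hsum
    exact absurd (mul_eq_zero.2 hsum) h0
  · exact h

theorem IsTileFunction.mem_arc_of_ne_zero {l₁ l₂ l₃ : ℕ} (h₁ : 2 ≤ l₁) (h₂ : 2 ≤ l₂) (h₃ : 2 ≤ l₃)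
    (hl : l₁ + l₂ + l₃ = d) {s : ZMod d} {a : ZMod d → ℂ} {φ : ZMod d → ZMod d → ℂ}
    (h : IsTileFunction l₁ l₂ l₃ s fun x y z => a x * φ y z)
    (hsum : ∑ x, ∑ y, ∑ z, a x * φ y z = 0) {x₀ y₀ z₀ : ZMod d} {j₀ : ℕ} (hj₀ : j₀ < l₁)
    (he : x₀ + y₀ + z₀ = s + j₀) (h0 : a x₀ * φ y₀ z₀ ≠ 0) {x y z : ZMod d}
    (hxyz : a x * φ y z ≠ 0) : ∃ j < l₁, x + y + z = s + j := by
  obtain ⟨hφ, ha⟩ := h.const_or_support h₁ h₂ h₃ hl hsum hj₀ he h0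
  rw [mul_ne_zero_iff] at hxyz
  rw [add_assoc, hφ y z hxyz.2, ← add_assoc]
  exact (ha x hxyz.1).1

/-- A product `b y * c z` supported on one value of `y + z` has a single nonzero entry. The total
sum is then a positive integer times `a x₀ * b y₀ * c z₀`, so it cannot vanish. -/
theorem IsTileFunction.eq_zero_of_mem_arc {l₁ l₂ l₃ : ℕ} (h₁ : 2 ≤ l₁) (h₂ : 2 ≤ l₂) (h₃ : 2 ≤ l₃)
    (hl : l₁ + l₂ + l₃ = d) {s : ZMod d} {a b c : ZMod d → ℂ}
    (h : IsTileFunction l₁ l₂ l₃ s fun x y z => a x * (b y * c z))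
    (hsum : ∑ x, ∑ y, ∑ z, a x * (b y * c z) = 0) {x₀ y₀ z₀ : ZMod d} {j₀ : ℕ} (hj₀ : j₀ < l₁)
    (he : x₀ + y₀ + z₀ = s + j₀) : a x₀ * (b y₀ * c z₀) = 0 := by
  by_contra h0
  obtain ⟨hφ, ha⟩ := h.const_or_support (φ := fun y z => b y * c z) h₁ h₂ h₃ hl hsum hj₀ he h0
  obtain ⟨ha0, hb0, hc0⟩ : a x₀ ≠ 0 ∧ b y₀ ≠ 0 ∧ c z₀ ≠ 0 := by simpa [not_or] using h0
  have hsa : ∑ x, a x = (Finset.univ.filter fun x => a x ≠ 0).card * a x₀ := by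
    rw [← Finset.sum_filter_ne_zero, Finset.sum_congr rfl
      fun x hx => (ha x (Finset.mem_filter.1 hx).2).2, Finset.sum_const, nsmul_eq_mul]
  have hsb : ∑ y, b y = b y₀ := by
    refine Finset.sum_eq_single y₀ (fun y _ hy => ?_) (by simp)
    by_contra hby
    exact hy (add_right_cancel (hφ y z₀ (mul_ne_zero hby hc0)))
  have hsc : ∑ z, c z = c z₀ := by
    refine Finset.sum_eq_single z₀ (fun z _ hz => ?_) (by simp)
    by_contra hcz
    exact hz (add_left_cancel (hφ y₀ z (mul_ne_zero hb0 hcz)))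
  simp_rw [← Finset.mul_sum, ← Finset.sum_mul, hsa, hsb, hsc] at hsum
  refine mul_ne_zero (mul_ne_zero ?_ ha0) (mul_ne_zero hb0 hc0) hsum
  exact Nat.cast_ne_zero.2 (Finset.card_ne_zero.2 ⟨x₀, by simpa using ha0⟩)

end Arcs

/-! ### Cyclic coordinates adapted to each tile direction. -/

section Complement

variable {d : ℕ}

variable (d) in
/-- The first element of the arc of values of `b - a - c` on the tiles of a given direction. -/
def arcStart (t : Fin 3) : ZMod d := ![-(arcLength d 0 : ZMod d), 0, 2] t

/-- Coordinates in which the cell `(a, b, c)` satisfies `b - a - c = x + y + z`, and `x` is the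
variable of the tiles of direction `t`. -/
def cellCoord (t : Fin 3) (x y z : ZMod d) : ZMod d × ZMod d × ZMod d :=
  ![(-x, z, -y), (-z, y, -x), (-y, x, -z)] t

theorem exists_cellCoord_tileCell (p : Σ τ : TileIndex d, Fin (tileLength d τ)) :
    ∃ (x y z : ZMod d) (j : ℕ), tileCell p = cellCoord p.1.1 x y z ∧ j < arcLength d p.1.1 ∧
      x + y + z = arcStart d p.1.1 + j := by
  obtain ⟨⟨t, k, i⟩, j, hj⟩ := p
  have hj' : j < arcLength d t := hj
  have hcast : ((arcLength d t - 1 - j : ℕ) : ZMod d) = arcLength d t - 1 - j := by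
    rw [Nat.cast_sub (by omega), Nat.cast_sub (by omega), Nat.cast_one]
  fin_cases t
  -- Here `x = -a`, so the tile is traversed against the arc and `j` is reflected. The same happens
  -- in direction 1, where `x = -c`, but not in direction 2, where `x = b`.
  · refine ⟨-(j + k + 1 - i), -i, k, arcLength d 0 - 1 - j, ?_, ?_, ?_⟩
    · simp [tileCell, cellCoord]
    · simp only [Fin.zero_eta] at hj' ⊢; omega
    · simp only [Fin.zero_eta] at hcast
      simp only [arcStart, Fin.zero_eta, Matrix.cons_val, hcast]; ring
  · refine ⟨-(i - k - 1 + j), i, -k, arcLength d 1 - 1 - j, ?_, ?_, ?_⟩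
    · simp [tileCell, cellCoord]
    · simp only [Fin.mk_one] at hj' ⊢; omega
    · simp only [Fin.mk_one] at hcast
      simp only [arcStart, Fin.mk_one, Matrix.cons_val, hcast]
      simp only [arcLength, Matrix.cons_val]
      push_cast
      ring
  · refine ⟨j + k + 2 + i, -k, -i, j, ?_, hj', ?_⟩
    · simp [tileCell, cellCoord]
    · simp only [arcStart, Fin.reduceFinMk, Matrix.cons_val]; ring

theorem exists_tileCell_eq_cellCoord {t : Fin 3} {x y z : ZMod d} {j : ℕ}
    (hj : j < arcLength d t) (he : x + y + z = arcStart d t + j) :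
    ∃ p : Σ τ : TileIndex d, Fin (tileLength d τ), p.1.1 = t ∧ tileCell p = cellCoord t x y z := by
  have hcast : ((arcLength d t - 1 - j : ℕ) : ZMod d) = arcLength d t - 1 - j := by
    rw [Nat.cast_sub (by omega), Nat.cast_sub (by omega), Nat.cast_one]
  fin_cases t
  · simp only [Fin.zero_eta] at hj hcast he
    refine ⟨⟨(0, z, -y), ⟨arcLength d 0 - 1 - j, by simp only [tileLength]; omega⟩⟩, rfl, ?_⟩
    simp only [arcStart, Matrix.cons_val] at he
    simp only [tileCell, cellCoord, hcast, Fin.zero_eta, Matrix.cons_val, Prod.mk.injEq, and_true]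
    linear_combination he
  · simp only [Fin.mk_one] at hj hcast he
    refine ⟨⟨(1, -z, y), ⟨arcLength d 1 - 1 - j, by simp only [tileLength]; omega⟩⟩, rfl, ?_⟩
    simp only [arcStart, Matrix.cons_val] at he
    simp only [tileCell, cellCoord, hcast, Fin.mk_one, Matrix.cons_val, Prod.mk.injEq, true_and]
    simp only [arcLength, Matrix.cons_val]
    push_cast
    linear_combination he
  · simp only [Fin.reduceFinMk] at hj he
    refine ⟨⟨(2, -y, -z), ⟨j, hj⟩⟩, rfl, ?_⟩
    simp only [arcStart, Matrix.cons_val] at he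
    simp only [tileCell, cellCoord, Fin.reduceFinMk, Matrix.cons_val, Prod.mk.injEq, true_and,
      and_true]
    linear_combination -he

theorem exists_eq_cellCoord (t : Fin 3) (k : ZMod d × ZMod d × ZMod d) :
    ∃ x y z, k = cellCoord t x y z := by
  obtain ⟨a, b, c⟩ := k
  fin_cases t
  · exact ⟨-a, -c, b, by simp [cellCoord]⟩
  · exact ⟨-c, b, -a, by simp [cellCoord]⟩
  · exact ⟨b, -a, -c, by simp [cellCoord]⟩

theorem arcLength_rotate_sum (hd : 6 ≤ d) (t : Fin 3) :
    arcLength d t + arcLength d (t + 1) + arcLength d (t + 2) = d := by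
  refine Eq.trans ?_ (arcLength_sum hd)
  fin_cases t
  · rfl
  · change arcLength d 1 + arcLength d 2 + arcLength d 0 = _
    ring
  · change arcLength d 2 + arcLength d 0 + arcLength d 1 = _
    ring

variable [NeZero d]

theorem tiling_apply (hd : 6 ≤ d) (p : Σ τ : TileIndex d, Fin (tileLength d τ)) :
    tiling hd p = tileCell p := rfl

theorem sum_cellCoord (t : Fin 3) (f : ZMod d × ZMod d × ZMod d → ℂ) :
    ∑ x, ∑ y, ∑ z, f (cellCoord t x y z) = ∑ k, f k := by
  have hneg (f : ZMod d → ℂ) : ∑ x, f (-x) = ∑ x, f x := Equiv.sum_comp (Equiv.neg (ZMod d)) f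
  simp only [Fintype.sum_prod_type]
  fin_cases t
  · simp only [cellCoord, Fin.zero_eta, Matrix.cons_val]
    rw [hneg fun x => ∑ y, ∑ z, f (x, z, -y)]
    refine Finset.sum_congr rfl fun x _ => ?_
    rw [hneg fun y => ∑ z, f (x, z, y), Finset.sum_comm]
  · simp only [cellCoord, Fin.mk_one, Matrix.cons_val]
    rw [hneg fun x => ∑ y, ∑ z, f (-z, y, x), Finset.sum_comm_cycle]
    rw [hneg fun z => ∑ x, ∑ y, f (z, y, x)]
    exact Finset.sum_congr rfl fun z _ => Finset.sum_comm
  · simp only [cellCoord, Fin.reduceFinMk, Matrix.cons_val]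
    rw [Finset.sum_comm, hneg fun y => ∑ x, ∑ z, f (y, x, -z)]
    exact Finset.sum_congr rfl fun y _ => Finset.sum_congr rfl fun x _ => hneg fun z => f (y, x, z)

theorem isTileFunction_repr (hd : 6 ≤ d) {ψ : ThreeQudits d} (hψ : ψ ∈ compl (U4 d))
    (t : Fin 3) :
    IsTileFunction (arcLength d t) (arcLength d (t + 1)) (arcLength d (t + 2)) (arcStart d t)
      fun x y z => (ket₃ d).repr ψ (cellCoord t x y z) := by
  rw [U4_eq_tileSet hd] at hψ
  have hconst (τ : TileIndex d) (i j : ℕ) (hi : i < tileLength d τ) (hj : j < tileLength d τ) :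
      (ket₃ d).repr ψ (tileCell ⟨τ, ⟨i, hi⟩⟩) = (ket₃ d).repr ψ (tileCell ⟨τ, ⟨j, hj⟩⟩) :=
    repr_eq_of_mem_compl _ (tiling hd) hψ τ ⟨i, hi⟩ ⟨j, hj⟩
  have h0 : IsTileFunction (arcLength d 0) (arcLength d 1) (arcLength d 2) (arcStart d 0)
      fun x y z => (ket₃ d).repr ψ (cellCoord 0 x y z) := by
    constructor
    · intro x y z j hj he
      simp only [arcStart, Matrix.cons_val] at he
      have hcast : ((arcLength d 0 - 2 - j : ℕ) : ZMod d) = arcLength d 0 - 2 - j := by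
        rw [Nat.cast_sub (by omega), Nat.cast_sub (by omega), Nat.cast_two]
      convert hconst (0, z, -y) (arcLength d 0 - 2 - j + 1) (arcLength d 0 - 2 - j)
        (by simp only [tileLength]; omega) (by simp only [tileLength]; omega) using 3 <;>
      · simp only [tileCell, cellCoord, Nat.cast_add, hcast, Nat.cast_one, Matrix.cons_val,
          Prod.mk.injEq, and_true]
        linear_combination -he
    · intro x y z j hj he
      -- The tiles of `C` have two cells, hence a single step.
      obtain rfl : j = 0 := by simp only [arcLength, Matrix.cons_val] at hj; omega
      simp only [arcStart, Matrix.cons_val, Nat.cast_zero] at he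
      convert hconst (1, -x, z) 1 0 (by simp [arcLength]) (by simp [arcLength]) using 3 <;>
      · simp only [tileCell, cellCoord, Nat.cast_zero, Nat.cast_one, Matrix.cons_val,
          Prod.mk.injEq, true_and]
        linear_combination -he
    · intro x y z j hj he
      simp only [arcStart, Matrix.cons_val] at he
      convert hconst (2, -x, -y) j (j + 1) (by simp only [tileLength]; omega)
        (by simp only [tileLength]; omega) using 3 <;>
      · simp only [tileCell, cellCoord, Nat.cast_add, Nat.cast_one, Matrix.cons_val,
          Prod.mk.injEq, true_and, and_true]
        have : (arcLength d 1 : ZMod d) = 2 := by simp [arcLength]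
        linear_combination he + this
  have hl := arcLength_sum hd
  have h1 := h0.rotate hl
  have h2 := h1.rotate (by omega)
  have hs : arcStart d 0 + (arcLength d 0 : ZMod d) = arcStart d 1 := by simp [arcStart]
  have hs' : arcStart d 1 + (arcLength d 1 : ZMod d) = arcStart d 2 := by
    simp [arcStart, arcLength]
  rw [hs] at h1 h2
  rw [hs'] at h2
  fin_cases t
  · exact h0
  · exact h1
  · exact h2

theorem sum_repr_cellCoord (hd : 6 ≤ d) {ψ : ThreeQudits d} (hψ : ψ ∈ compl (U4 d)) (t : Fin 3) :
    ∑ x, ∑ y, ∑ z, (ket₃ d).repr ψ (cellCoord t x y z) = 0 := by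
  rw [U4_eq_tileSet hd] at hψ
  rw [sum_cellCoord t fun k => (ket₃ d).repr ψ k]
  exact sum_repr_of_mem_compl _ _ hψ

/-- The sum of the coordinates in the tiles of direction `t`. -/
def tileSum (hd : 6 ≤ d) (t : Fin 3) : ThreeQudits d →ₗ[ℂ] ℂ :=
  ∑ τ : TileIndex d with τ.1 = t,
    (innerSL ℂ (tileState (ket₃ d) (tiling hd) τ 0)).toLinearMap

theorem tileSum_apply (hd : 6 ≤ d) (t : Fin 3) (ψ : ThreeQudits d) :
    tileSum hd t ψ =
      ∑ τ : TileIndex d with τ.1 = t, inner ℂ (tileState (ket₃ d) (tiling hd) τ 0) ψ := by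
  simp [tileSum]

theorem tileSum_tileState (hd : 6 ≤ d) (t : Fin 3) (τ : TileIndex d) :
    tileSum hd t (tileState (ket₃ d) (tiling hd) τ 0) =
      if τ.1 = t then (tileLength d τ : ℂ) else 0 := by
  have hpos : 0 < tileLength d τ := two_pos.trans_le (two_le_arcLength hd τ.1)
  rw [tileSum_apply, Finset.sum_filter]
  rw [Finset.sum_eq_single τ (fun σ _ hσ => by
    rw [inner_tileState_of_ne _ _ hσ, ite_self]) (by simp), inner_tileState_same _ _ hpos hpos,
    if_pos rfl]

/-- The two tiles of the witness have different directions, so `tileSum` sees only one of them. -/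
theorem exists_mem_compl_tileSum_ne_zero (hd : 6 ≤ d) (t : Fin 3) :
    ∃ χ ∈ compl (U4 d), tileSum hd t χ ≠ 0 := by
  have hpos (t : Fin 3) : 0 < arcLength d t := by have := two_le_arcLength hd t; omega
  refine ⟨tileDiff (ket₃ d) (tiling hd) (t, 0, 0) (t + 1, 0, 0), ?_, ?_⟩
  · rw [U4_eq_tileSet hd]
    exact tileDiff_mem_compl _ _ (hpos _) (hpos _)
  · rw [tileDiff, map_sub, map_smul, map_smul, tileSum_tileState, tileSum_tileState, if_pos rfl,
      if_neg (by simp)]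
    simp [(hpos _).ne']

/-- If some coordinate on a tile of direction `t` is nonzero, rigidity makes all coordinates on
other tiles vanish. The partial sum is then the total sum, which is zero. -/
theorem tileSum_eq_zero (hd : 6 ≤ d) {ψ : ThreeQudits d} (hψ : ψ ∈ compl (U4 d)) (t : Fin 3)
    {a : ZMod d → ℂ} {φ : ZMod d → ZMod d → ℂ}
    (h : ∀ x y z, (ket₃ d).repr ψ (cellCoord t x y z) = a x * φ y z) : tileSum hd t ψ = 0 := by
  have hF := isTileFunction_repr hd hψ t
  have hsum := sum_repr_cellCoord hd hψ t
  simp_rw [h] at hF hsum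
  have hF' {x₀ y₀ z₀ : ZMod d} {j₀ : ℕ} := hF.mem_arc_of_ne_zero (two_le_arcLength hd _)
    (two_le_arcLength hd _) (two_le_arcLength hd _) (arcLength_rotate_sum hd t) hsum
    (x₀ := x₀) (y₀ := y₀) (z₀ := z₀) (j₀ := j₀)
  by_contra hne
  rw [tileSum_apply] at hne
  obtain ⟨τ, hτ, hτne⟩ := Finset.exists_ne_zero_of_sum_ne_zero hne
  rw [inner_tileState] at hτne
  obtain ⟨i, -, hi⟩ := Finset.exists_ne_zero_of_sum_ne_zero hτne
  obtain rfl : τ.1 = t := (Finset.mem_filter.1 hτ).2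
  obtain ⟨x₀, y₀, z₀, j₀, hcell, hj₀, he⟩ := exists_cellCoord_tileCell ⟨τ, i⟩
  replace hi := (mul_ne_zero_iff.1 hi).2
  rw [tiling_apply, hcell, h] at hi
  have hall (p : Σ τ : TileIndex d, Fin (tileLength d τ)) (hp : p.1.1 ≠ τ.1) :
      (ket₃ d).repr ψ (tiling hd p) = 0 := by
    by_contra hp0
    obtain ⟨x, y, z, hxyz⟩ := exists_eq_cellCoord τ.1 (tiling hd p)
    rw [hxyz, h] at hp0
    obtain ⟨j, hj, he'⟩ := hF' hj₀ he hi hp0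
    obtain ⟨q, hq, hq'⟩ := exists_tileCell_eq_cellCoord hj he'
    rw [← hq', ← tiling_apply hd, (tiling hd).injective.eq_iff] at hxyz
    exact hp (hxyz ▸ hq)
  apply hne
  rw [U4_eq_tileSet hd] at hψ
  rw [← sum_repr_of_mem_compl _ _ hψ, ← (tiling hd).sum_comp, Fintype.sum_sigma,
    Finset.sum_filter]
  refine Finset.sum_congr rfl fun σ _ => ?_
  split_ifs with hσ
  · simp [inner_tileState]
  · exact (Finset.sum_eq_zero fun j _ => hall ⟨σ, j⟩ hσ).symm

theorem not_isProductState₃_of_mem_compl (hd : 6 ≤ d) {ψ : ThreeQudits d}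
    (hψ : ψ ∈ compl (U4 d)) : ¬ IsProductState₃ ψ := by
  rintro ⟨hne, a, b, c, rfl⟩
  apply hne
  set α := fun x => (ketBasis d).repr a x
  set β := fun x => (ketBasis d).repr b x
  set γ := fun x => (ketBasis d).repr c x
  have hrepr (x y z : ZMod d) :
      (ket₃ d).repr (a ⊗ₜ[ℂ] (b ⊗ₜ[ℂ] c)) (x, y, z) = α x * β y * γ z := by
    simp only [ket₃, OrthonormalBasis.tensorProduct_repr_tmul_apply, α, β, γ]
    ring
  have key (t : Fin 3) : ∃ a' b' c' : ZMod d → ℂ, ∀ x y z,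
      (ket₃ d).repr (a ⊗ₜ[ℂ] (b ⊗ₜ[ℂ] c)) (cellCoord t x y z) = a' x * (b' y * c' z) := by
    fin_cases t
    · exact ⟨fun x => α (-x), fun y => γ (-y), β, fun x y z => (hrepr _ _ _).trans (by ring)⟩
    · exact ⟨fun x => γ (-x), β, fun z => α (-z), fun x y z => (hrepr _ _ _).trans (by ring)⟩
    · exact ⟨β, fun y => α (-y), fun z => γ (-z), fun x y z => (hrepr _ _ _).trans (by ring)⟩
  refine (ket₃ d).repr.map_eq_zero_iff.1 (PiLp.ext fun k => ?_)
  obtain ⟨p, rfl⟩ := tileCell_surjective hd k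
  obtain ⟨x, y, z, j, hcell, hj, he⟩ := exists_cellCoord_tileCell p
  obtain ⟨a', b', c', h⟩ := key p.1.1
  have hF := isTileFunction_repr hd hψ p.1.1
  have hsum := sum_repr_cellCoord hd hψ p.1.1
  simp_rw [h] at hF hsum
  rw [hcell, h]
  exact hF.eq_zero_of_mem_arc (two_le_arcLength hd _) (two_le_arcLength hd _)
    (two_le_arcLength hd _) (arcLength_rotate_sum hd _) hsum hj he

end Complement

/-! ### The main theorem -/

section Main

variable {d : ℕ} [NeZero d]

theorem ne_zero_of_mem_U4 (hd : 6 ≤ d) {ψ : ThreeQudits d} (hψ : ψ ∈ U4 d) : ψ ≠ 0 := by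
  rw [U4_eq_tileSet hd] at hψ
  obtain ⟨τ, m, -, hm, rfl⟩ | rfl := hψ
  · exact tileState_ne_zero _ _ hm
  · exact sum_basis_ne_zero _

theorem exists_tmul_of_mem_U4 {ψ : ThreeQudits d} (hψ : ψ ∈ U4 d) :
    ∃ a b c, ψ = a ⊗ₜ[ℂ] (b ⊗ₜ[ℂ] c) := by
  obtain h | rfl := hψ
  · simp only [Set.mem_iUnion] at h
    obtain ⟨k, i, (⟨m, -, rfl⟩ | ⟨m, -, rfl⟩) | ⟨m, -, rfl⟩, -⟩ := h <;> exact ⟨_, _, _, rfl⟩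
  · exact ⟨_, _, _, rfl⟩

theorem U4_pairwise (hd : 6 ≤ d) : (U4 d).Pairwise (fun ψ φ => inner ℂ ψ φ = 0) := by
  rw [U4_eq_tileSet hd]
  exact tileSet_pairwise _ _

theorem span_U4_ne_top (hd : 6 ≤ d) : Submodule.span ℂ (U4 d) ≠ ⊤ := by
  obtain ⟨χ, hχ, hne⟩ := exists_mem_compl_tileSum_ne_zero hd 0
  refine span_ne_top_of_mem_compl hχ ?_
  rintro rfl
  exact hne (map_zero _)

theorem isUPB_U4 (hd : 6 ≤ d) : IsUPB IsProductState₃ (U4 d) := by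
  refine ⟨⟨⟨fun ψ hψ => ⟨ne_zero_of_mem_U4 hd hψ, exists_tmul_of_mem_U4 hψ⟩, U4_pairwise hd,
    span_U4_ne_top hd⟩, fun T hT _ => ?_⟩, fun ψ hψ => not_isProductState₃_of_mem_compl hd hψ⟩
  -- Without product states in the complement, uncompletability only requires that the complement be
  -- nonzero.
  have hempty : T = ∅ := Set.eq_empty_of_forall_notMem
    fun ψ hψ => not_isProductState₃_of_mem_compl hd (hT ψ hψ).1 (hT ψ hψ).2
  rw [hempty, Set.encard_empty, Nat.cast_pos, Nat.pos_iff_ne_zero, Ne, Submodule.finrank_eq_zero,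
    compl, Submodule.orthogonal_eq_bot_iff]
  exact span_U4_ne_top hd

/-- `𝒰⁴` is strongly uncompletable in any bipartition that separates the variable of the tiles of
some direction from the other two. -/
theorem isSUCPB_image_U4 (hd : 6 ≤ d) (t : Fin 3)
    (Φ : ThreeQudits d ≃ₗ[ℂ] Qudit d ⊗[ℂ] (Qudit d ⊗[ℂ] Qudit d))
    (hinner : ∀ ψ φ, inner ℂ (Φ ψ) (Φ φ) = inner ℂ ψ φ)
    (hΦ : ∀ a b c, ∃ a' b', Φ (a ⊗ₜ[ℂ] (b ⊗ₜ[ℂ] c)) = a' ⊗ₜ[ℂ] b')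
    (u : ZMod d → Qudit d) (v : ZMod d → ZMod d → Qudit d ⊗[ℂ] Qudit d)
    (huv : ∀ x y z, Φ (ket₃ d (cellCoord t x y z)) = u x ⊗ₜ[ℂ] v y z) : IsSUCPB (Φ '' U4 d) := by
  have hcompl {ψ} (hψ : ψ ∈ compl (Φ '' U4 d)) : Φ.symm ψ ∈ compl (U4 d) :=
    mem_compl.2 fun φ hφ => by
      rw [← hinner, Φ.apply_symm_apply]
      exact mem_compl.1 hψ _ ⟨φ, hφ, rfl⟩
  obtain ⟨χ, hχ, hne⟩ := exists_mem_compl_tileSum_ne_zero hd t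
  refine isSUCPB_of_functional ?_ ?_ (tileSum hd t ∘ₗ Φ.symm.toLinearMap) ?_
    (χ := Φ χ) ?_ ?_
  · rintro _ ⟨ψ, hψ, rfl⟩
    refine ⟨fun h => ne_zero_of_mem_U4 hd hψ (Φ.injective (h.trans (map_zero Φ).symm)), ?_⟩
    obtain ⟨a, b, c, rfl⟩ := exists_tmul_of_mem_U4 hψ
    exact hΦ a b c
  · rintro _ ⟨ψ, hψ, rfl⟩ _ ⟨φ, hφ, rfl⟩ h
    rw [hinner]
    exact U4_pairwise hd hψ hφ fun h' => h (h' ▸ rfl)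
  · intro a b hab
    -- By `huv` the basis vectors are products across the bipartition, so the coordinates of `a ⊗ b`
    -- factor as a function of `x` times a function of `(y, z)`.
    refine tileSum_eq_zero hd (hcompl hab) t (a := fun x => inner ℂ (u x) a)
      (φ := fun y z => inner ℂ (v y z) b) fun x y z => ?_
    change (ket₃ d).repr (Φ.symm (a ⊗ₜ[ℂ] b)) _ = _
    rw [OrthonormalBasis.repr_apply_apply, ← hinner, Φ.apply_symm_apply, huv,
      TensorProduct.inner_tmul]
  · refine mem_compl.2 ?_
    rintro _ ⟨φ, hφ, rfl⟩
    rw [hinner]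
    exact mem_compl.1 hχ φ hφ
  · change tileSum hd t (Φ.symm (Φ χ)) ≠ 0
    rwa [Φ.symm_apply_apply]

theorem inner_cyc {E F G : Type*} [NormedAddCommGroup E] [InnerProductSpace ℂ E]
    [NormedAddCommGroup F] [InnerProductSpace ℂ F] [NormedAddCommGroup G] [InnerProductSpace ℂ G]
    (ψ φ : E ⊗[ℂ] (F ⊗[ℂ] G)) : inner ℂ (cyc E F G ψ) (cyc E F G φ) = inner ℂ ψ φ :=
  (TensorProduct.inner_assoc_assoc _ _).trans (TensorProduct.inner_comm_comm _ _)

theorem isSUCPB_inA_BC (hd : 6 ≤ d) : IsSUCPB (inA_BC d (U4 d)) := by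
  have h := isSUCPB_image_U4 hd 0 (LinearEquiv.refl ℂ _) (fun _ _ => rfl)
    (fun a b c => ⟨_, _, rfl⟩) (fun x => ket d (-x)) (fun y z => ket d z ⊗ₜ[ℂ] ket d (-y))
    (fun x y z => ket₃_apply (-x) z (-y))
  rwa [show ⇑(LinearEquiv.refl ℂ (ThreeQudits d)) '' U4 d = U4 d from Set.image_id _] at h

theorem isSUCPB_inB_CA (hd : 6 ≤ d) : IsSUCPB (inB_CA d (U4 d)) :=
  isSUCPB_image_U4 hd 2 (cyc _ _ _).toLinearEquiv inner_cyc
    (fun a b c => ⟨_, _, cyc_tmul a b c⟩)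
    (fun x => ket d x) (fun y z => ket d (-z) ⊗ₜ[ℂ] ket d (-y))
    (fun x y z => by
      change cyc _ _ _ (ket₃ d (-y, x, -z)) = _
      rw [ket₃_apply, cyc_tmul])

theorem isSUCPB_inC_AB (hd : 6 ≤ d) : IsSUCPB (inC_AB d (U4 d)) := by
  rw [inC_AB, Set.image_image]
  exact isSUCPB_image_U4 hd 1 ((cyc _ _ _).toLinearEquiv.trans (cyc _ _ _).toLinearEquiv)
    (fun ψ φ => (inner_cyc _ _).trans (inner_cyc _ _))
    (fun a b c => ⟨c, a ⊗ₜ[ℂ] b, by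
      change cyc _ _ _ (cyc _ _ _ (a ⊗ₜ[ℂ] (b ⊗ₜ[ℂ] c))) = _
      rw [cyc_tmul, cyc_tmul]⟩)
    (fun x => ket d (-x)) (fun y z => ket d (-z) ⊗ₜ[ℂ] ket d y)
    (fun x y z => by
      change cyc _ _ _ (cyc _ _ _ (ket₃ d (-z, y, -x))) = _
      rw [ket₃_apply, cyc_tmul, cyc_tmul])

end Main

end ProductBasis

end

theorem mainTheorem1 (d : ℕ) [NeZero d] (hd : 6 ≤ d) :
    ProductBasis.IsUPB ProductBasis.IsProductState₃ (ProductBasis.U4 d) ∧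
    ((ProductBasis.U4 d).ncard : ℤ) = (d : ℤ) ^ 3 - 3 * (d : ℤ) ^ 2 + 1 ∧
    ProductBasis.IsSUCPB (ProductBasis.inA_BC d (ProductBasis.U4 d)) ∧
    ProductBasis.IsSUCPB (ProductBasis.inB_CA d (ProductBasis.U4 d)) ∧
    ProductBasis.IsSUCPB (ProductBasis.inC_AB d (ProductBasis.U4 d)) :=
  ⟨ProductBasis.isUPB_U4 hd, ProductBasis.ncard_U4 hd, ProductBasis.isSUCPB_inA_BC hd,
    ProductBasis.isSUCPB_inB_CA hd, ProductBasis.isSUCPB_inC_AB hd⟩
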